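/- Consider the single-input/single-output system $\dot x=f(x,u)$, $y=h(x)$ with $x\in\mathbb R^n$, $u,y\in\mathbb R$ and $f,h$ of class $C^\infty$. Admissible inputs are the Lebesgue measurable, locally essentially bounded functions $u:[0,\infty)\to\mathbb R$; solutions are understood in the Carathéodory sense. $|\cdot|$ is the Euclidean norm, and $\|z\|_{[0,t]}=\sup_{0\le s\le t}|z(s)|$ (the signals below are continuous, so for $t>0$ this is the essential supremum). A function $\alpha:[0,\infty)\to[0,\infty)$ is of class $\mathcal K$ if it is continuous, strictly increasing and $\alpha(0)=0$, and of class $\mathcal K_\infty$ if it is moreover unbounded; $\beta:[0,\infty)^2\to[0,\infty)$ is of class $\mathcal{KL}$ if $\beta(\cdot,t)\in\mathcal K$ for each $t\ge0$ and, for each $s\ge 0$, $\beta(s,t)$ decreases (not necessarily strictly) to $0$ as $t\to\infty$. Define $H_0(x)=h(x)$ and $$H_{k+1}(x,u_0,\dots,u_k)=\frac{\partial H_k}{\partial x}f(x,u_0)+\sum_{j=0}^{k-1}\frac{\partial H_k}{\partial u_j}u_{j+1},$$ where $H_k$ has the arguments $(x,u_0,\dots,u_{k-1})$. * *Relative degree.*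 A positive integer $r$ is the relative degree of the system if, for each $k<r$, $H_k$ is independent of $u_0,\dots,u_{k-1}$ (so that $H_r$ depends only on $x$ and $u_0$), and there are $\rho_1,\rho_2\in\mathcal K_\infty$ with $|u_0|\le\rho_1(|x|)+\rho_2(|H_r(x,u_0)|)$ for all $x\in\mathbb R^n$, $u_0\in\mathbb R$. * *Output-input stability with $N$.* For a positive integer $N$: there are $\beta\in\mathcal{KL}$, $\gamma\in\mathcal K_\infty$ such that for every initial state $x(0)$ and every $N-1$ times continuously differentiable input $u$, $$\left|\begin{pmatrix}u(t)\\x(t)\end{pmatrix}\right|\le\beta(|x(0)|,t)+\gamma\big(\|\mathbf y^N\|_{[0,t]}\big),\qquad \mathbf y^N=(y;\dot y;\dots;y^{(N)}),$$ for all $t\geq 0$ in the domain of the corresponding solution. * *Weak uniform 0-detectability of order $k$.* For an integer $k\ge0$: there are $\beta\in\mathcal{KL}$, $\gamma\in\mathcal K_\infty$ such that for every initial state $x(0)$ and every input $u$ of class $C^{k-1}$ (every admissible input if $k=0$), $$|x(t)|\le\beta(|x(0)|,t)+\gamma\big(\|\mathbf h_k\|_{[0,t]}\big),\qquad \mathbf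 h_k=\big(H_0(x);H_1(x,u);\dots;H_k(x,u,\dots,u^{(k-1)})\big)$$ for all $t\ge 0$ in the domain of the corresponding solution. **Theorem 1.** 1. If the system has a relative degree $r$ and is weakly uniformly 0-detectable of order $k$ for some $k\ge 0$, then it is output-input stable with $N=\max\{r,k\}$. 2. If the system is output-input stable with $N$, then it is weakly uniformly 0-detectable of order $N$. 3. If the system is output-input stable with $N$, if $f(x,\cdot)$ is real analytic in $u$ for each fixed $x$, and if $f(0,0)=0$ and $h(0)=0$, then the system has a relative degree $r\le N$. -/

import Mathlib

open Set MeasureTheory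
open scoped ContDiff

noncomputable section

/-- Class `K`: continuous, strictly increasing functions `[0,∞) → [0,∞)` vanishing at `0`.
Only the values on `[0,∞)` matter. -/
structure ClassK (α : ℝ → ℝ) : Prop where
  continuousOn : ContinuousOn α (Ici 0)
  strictMonoOn : StrictMonoOn α (Ici 0)
  map_zero : α 0 = 0

/-- Class `K_∞`: unbounded class `K` functions. -/
structure ClassKInf (α : ℝ → ℝ) : Prop where
  classK : ClassK α
  unbounded : ∀ M : ℝ, ∃ s : ℝ, 0 ≤ s ∧ M < α s

/-- Class `KL`: `β(·, t)` is of class `K` for each `t ≥ 0`, and `β(s, t)` decreases to `0` as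
`t → ∞` for each `s ≥ 0`. -/
structure ClassKL (β : ℝ → ℝ → ℝ) : Prop where
  classK : ∀ t : ℝ, 0 ≤ t → ClassK (fun s => β s t)
  antitoneOn : ∀ s : ℝ, 0 ≤ s → AntitoneOn (β s) (Ici 0)
  tendsto_zero : ∀ s : ℝ, 0 ≤ s → Filter.Tendsto (β s) Filter.atTop (nhds 0)

/-- The norm of a signal on `[0, t]`. All the signals it is applied to are continuous on `[0, t]`,
so that for `t > 0` it is their essential supremum norm; for `t = 0` it is `|z(0)|`. -/
def supNorm {F : Type*} [NormedAddCommGroup F] (z : ℝ → F) (t : ℝ) : ℝ :=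
  sSup ((fun s => ‖z s‖) '' Icc 0 t)

/-- Admissible inputs: Lebesgue measurable and locally essentially bounded on `[0,∞)`. -/
structure IsAdmissibleInput (u : ℝ → ℝ) : Prop where
  aemeasurable : AEMeasurable u (volume.restrict (Ici 0))
  locally_essentially_bounded :
    ∀ b : ℝ, ∃ M : ℝ, ∀ᵐ t ∂(volume.restrict (Icc 0 b)), |u t| ≤ M

/-- Inputs `u : [0,∞) → ℝ` of class `C^{k-1}`; for `k = 0` no smoothness is required and these
are all the admissible inputs. -/
def InputClass : ℕ → (ℝ → ℝ) → Prop
  | 0, u => IsAdmissibleInput u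
  | k + 1, u => ContDiffOn ℝ k u (Ici 0)

/-- The interval `[0, T)`, where `T` may be `+∞`. -/
def timeDomain (T : EReal) : Set ℝ := {t | 0 ≤ t ∧ (t : EReal) < T}

variable {n : ℕ}

/-- `x` is a (Carathéodory) solution of `ẋ = f(x, u)` on `[0, T)`. -/
structure IsSolution (f : EuclideanSpace ℝ (Fin n) → ℝ → EuclideanSpace ℝ (Fin n))
    (u : ℝ → ℝ) (T : EReal) (x : ℝ → EuclideanSpace ℝ (Fin n)) : Prop where
  continuousOn : ContinuousOn x (timeDomain T)
  intervalIntegrable : ∀ t ∈ timeDomain T,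
    IntervalIntegrable (fun s => f (x s) (u s)) volume 0 t
  integral_eq : ∀ t ∈ timeDomain T, x t = x 0 + ∫ s in (0 : ℝ)..t, f (x s) (u s)

/-- The functions `H_k(x, u₀, …, u_{k-1})`: `H_0 = h` and
`H_{k+1}(x, u₀, …, u_k) = (∂H_k/∂x) f(x, u₀) + ∑_{j<k} (∂H_k/∂u_j) u_{j+1}`. -/
def outputH (f : EuclideanSpace ℝ (Fin n) → ℝ → EuclideanSpace ℝ (Fin n))
    (h : EuclideanSpace ℝ (Fin n) → ℝ) :
    (k : ℕ) → EuclideanSpace ℝ (Fin n) → (Fin k → ℝ) → ℝ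
  | 0, x, _ => h x
  | k + 1, x, u =>
      fderiv ℝ (fun z => outputH f h k z (fun i => u i.castSucc)) x (f x (u 0)) +
        ∑ j : Fin k,
          fderiv ℝ (fun w => outputH f h k x w) (fun i => u i.castSucc) (Pi.single j 1) * u j.succ

/-- `r` is the (uniform) relative degree of `ẋ = f(x, u)`, `y = h(x)`. In the bound, `H_r` is
evaluated at `(x, v₀, …, v_{r-1})`; it depends only on `x` and `v₀` by the preceding clause. -/
def HasRelativeDegree (f : EuclideanSpace ℝ (Fin n) → ℝ → EuclideanSpace ℝ (Fin n))
    (h : EuclideanSpace ℝ (Fin n) → ℝ) (r : ℕ) : Prop :=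
  ∃ hr : 0 < r,
    (∀ k < r, ∀ (x : EuclideanSpace ℝ (Fin n)) (v w : Fin k → ℝ),
      outputH f h k x v = outputH f h k x w) ∧
    ∃ ρ₁ ρ₂ : ℝ → ℝ, ClassKInf ρ₁ ∧ ClassKInf ρ₂ ∧
      ∀ (x : EuclideanSpace ℝ (Fin n)) (v : Fin r → ℝ),
        |v ⟨0, hr⟩| ≤ ρ₁ ‖x‖ + ρ₂ |outputH f h r x v|

/-- The signal `𝐲^N = (y; ẏ; …; y^{(N)})` in `ℝ^{N+1}`, for an output `y` defined on the
interval `J` (the derivative at an end point belonging to `J` is one-sided). -/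
def derivStack (y : ℝ → ℝ) (J : Set ℝ) (N : ℕ) (t : ℝ) : EuclideanSpace ℝ (Fin (N + 1)) :=
  WithLp.toLp 2 (fun j => iteratedDerivWithin j y J t)

/-- The output `(H_0(x); H_1(x, u); …; H_k(x, u, …, u^{(k-1)}))` of the `k`-output extension,
along the state trajectory `x` and the input `u`. -/
def extendedOutput (f : EuclideanSpace ℝ (Fin n) → ℝ → EuclideanSpace ℝ (Fin n))
    (h : EuclideanSpace ℝ (Fin n) → ℝ) (k : ℕ)
    (x : ℝ → EuclideanSpace ℝ (Fin n)) (u : ℝ → ℝ) (t : ℝ) : EuclideanSpace ℝ (Fin (k + 1)) :=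
  WithLp.toLp 2 (fun j => outputH f h j (x t) (fun i => iteratedDerivWithin i u (Ici 0) t))

/-- Output-input stability of `ẋ = f(x, u)`, `y = h(x)` with the positive integer `N`. The
inequality at time `t` only involves `[0, t]`, so that it is required along every solution on
every interval `[0, T)`, maximal or not. -/
def OutputInputStable (f : EuclideanSpace ℝ (Fin n) → ℝ → EuclideanSpace ℝ (Fin n))
    (h : EuclideanSpace ℝ (Fin n) → ℝ) (N : ℕ) : Prop :=
  0 < N ∧ ∃ (β : ℝ → ℝ → ℝ) (γ : ℝ → ℝ), ClassKL β ∧ ClassKInf γ ∧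
    ∀ (u : ℝ → ℝ) (T : EReal) (x : ℝ → EuclideanSpace ℝ (Fin n)),
      InputClass N u → IsSolution f u T x → ∀ t ∈ timeDomain T,
        ‖WithLp.toLp 2 (u t, x t)‖ ≤
          β ‖x 0‖ t + γ (supNorm (derivStack (fun s => h (x s)) (timeDomain T) N) t)

/-- Weak uniform 0-detectability of order `k`: the `k`-output extension is uniformly
0-detectable. -/
def WeaklyUniformlyZeroDetectable
    (f : EuclideanSpace ℝ (Fin n) → ℝ → EuclideanSpace ℝ (Fin n))
    (h : EuclideanSpace ℝ (Fin n) → ℝ) (k : ℕ) : Prop :=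
  ∃ (β : ℝ → ℝ → ℝ) (γ : ℝ → ℝ), ClassKL β ∧ ClassKInf γ ∧
    ∀ (u : ℝ → ℝ) (T : EReal) (x : ℝ → EuclideanSpace ℝ (Fin n)),
      InputClass k u → IsSolution f u T x → ∀ t ∈ timeDomain T,
        ‖x t‖ ≤ β ‖x 0‖ t + γ (supNorm (extendedOutput f h k x u) t)

end

/-! ### Comparison functions -/

/-! Along a solution with a `C^{N-1}` input, `y^{(j)} = H_j(x, u, …, u^{(j-1)})` for `j ≤ N`
(`iteratedDerivWithin_output`), so the output jet and the extended output are one signal. Stability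
therefore gives detectability by forgetting `u`. Conversely, detectability bounds `x`, the relative
degree then bounds `u` by `x` and `H_r`, and `ClassK.apply_add_le` separates the two resulting
terms.

For the third claim, stability is read at time zero. Every input jet occurs there, so `|u₀|` is
bounded by `x` and all `H_j`, `j ≤ N`, at every point and jet (`OutputInputStable.exists_abs_le`).
Hence some `H_j` depends on the input; let `H_r = g(x, u₀)` be the first. Each `H_{r+j}` with `j ≥
1` is affine in `u_j` with slope `∂g/∂u₀`; where this is nonzero, `u₁, u₂, …` can be chosen
successively to annihilate `H_{r+1}, …, H_N` (`exists_jet_outputH_eq_zero`), leaving a bound by `x`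
and `g` alone.

Analyticity and connectedness of the state space extend this bound to all points
(`abs_le_of_deriv_ne_zero_imp`): for fixed `x`, `g(x, ·)` is either constant or has nonzero
derivative on a dense set. The equilibrium at the origin turns the remaining dependence on `x` into
a `K_∞` function. -/

theorem ClassK.mono {α : ℝ → ℝ} (hα : ClassK α) {a b : ℝ} (ha : 0 ≤ a) (hab : a ≤ b) :
    α a ≤ α b :=
  hα.strictMonoOn.monotoneOn ha (ha.trans hab) hab

theorem ClassK.nonneg {α : ℝ → ℝ} (hα : ClassK α) {a : ℝ} (ha : 0 ≤ a) : 0 ≤ α a := by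
  simpa [hα.map_zero] using hα.mono le_rfl ha

theorem ClassK.add {α₁ α₂ : ℝ → ℝ} (h₁ : ClassK α₁) (h₂ : ClassK α₂) :
    ClassK (fun s => α₁ s + α₂ s) where
  continuousOn := h₁.continuousOn.add h₂.continuousOn
  strictMonoOn := fun _ ha _ hb hab =>
    add_lt_add (h₁.strictMonoOn ha hb hab) (h₂.strictMonoOn ha hb hab)
  map_zero := by simp [h₁.map_zero, h₂.map_zero]

theorem ClassK.comp {α₁ α₂ : ℝ → ℝ} (h₁ : ClassK α₁) (h₂ : ClassK α₂) :
    ClassK (fun s => α₁ (α₂ s)) where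
  continuousOn := h₁.continuousOn.comp h₂.continuousOn (fun _ hs => h₂.nonneg hs)
  strictMonoOn := fun _ ha _ hb hab =>
    h₁.strictMonoOn (h₂.nonneg ha) (h₂.nonneg hb) (h₂.strictMonoOn ha hb hab)
  map_zero := by simp [h₁.map_zero, h₂.map_zero]

theorem ClassK.const_mul {α : ℝ → ℝ} (hα : ClassK α) {c : ℝ} (hc : 0 < c) :
    ClassK (fun s => c * α s) where
  continuousOn := continuousOn_const.mul hα.continuousOn
  strictMonoOn := fun _ ha _ hb hab => mul_lt_mul_of_pos_left (hα.strictMonoOn ha hb hab) hc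
  map_zero := by simp [hα.map_zero]

theorem classK_id : ClassK (fun s => s) where
  continuousOn := continuousOn_id
  strictMonoOn := fun _ _ _ _ hab => hab
  map_zero := rfl

theorem ClassK.comp_two_mul {α : ℝ → ℝ} (hα : ClassK α) : ClassK (fun s => α (2 * s)) :=
  hα.comp (classK_id.const_mul two_pos)

/-- Weak triangle inequality, from `a + b ≤ 2 max(a, b)`. -/
theorem ClassK.apply_add_le {α : ℝ → ℝ} (hα : ClassK α) {a b : ℝ} (ha : 0 ≤ a) (hb : 0 ≤ b) :
    α (a + b) ≤ α (2 * a) + α (2 * b) := by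
  have h2a := hα.nonneg (a := 2 * a) (by positivity)
  have h2b := hα.nonneg (a := 2 * b) (by positivity)
  rcases le_total a b with hab | hab
  · linarith [hα.mono (a := a + b) (b := 2 * b) (by positivity) (by linarith)]
  · linarith [hα.mono (a := a + b) (b := 2 * a) (by positivity) (by linarith)]

theorem ClassKInf.of_le {α₁ α₂ : ℝ → ℝ} (h₁ : ClassKInf α₁) (h₂ : ClassK α₂)
    (hle : ∀ s, 0 ≤ s → α₁ s ≤ α₂ s) : ClassKInf α₂ :=
  ⟨h₂, fun M => (h₁.unbounded M).imp fun s hs => ⟨hs.1, hs.2.trans_le (hle s hs.1)⟩⟩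

theorem ClassK.add_classKInf {α₁ α₂ : ℝ → ℝ} (h₁ : ClassK α₁) (h₂ : ClassKInf α₂) :
    ClassKInf (fun s => α₁ s + α₂ s) :=
  h₂.of_le (h₁.add h₂.classK) fun _ hs => le_add_of_nonneg_left (h₁.nonneg hs)

theorem ClassKInf.comp_two_mul {α : ℝ → ℝ} (hα : ClassKInf α) :
    ClassKInf (fun s => α (2 * s)) :=
  hα.of_le hα.classK.comp_two_mul fun _ hs => hα.classK.mono hs (by linarith)

theorem ClassKL.nonneg {β : ℝ → ℝ → ℝ} (hβ : ClassKL β) {s t : ℝ} (hs : 0 ≤ s) (ht : 0 ≤ t) :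
    0 ≤ β s t :=
  (hβ.classK t ht).nonneg hs

theorem ClassKL.add {β₁ β₂ : ℝ → ℝ → ℝ} (h₁ : ClassKL β₁) (h₂ : ClassKL β₂) :
    ClassKL (fun s t => β₁ s t + β₂ s t) where
  classK t ht := (h₁.classK t ht).add (h₂.classK t ht)
  antitoneOn s hs := (h₁.antitoneOn s hs).add (h₂.antitoneOn s hs)
  tendsto_zero s hs := by simpa using (h₁.tendsto_zero s hs).add (h₂.tendsto_zero s hs)

theorem ClassK.comp_classKL {α : ℝ → ℝ} {β : ℝ → ℝ → ℝ} (hα : ClassK α) (hβ : ClassKL β) :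
    ClassKL (fun s t => α (β s t)) where
  classK t ht := hα.comp (hβ.classK t ht)
  antitoneOn s hs := fun _ ha _ hb hab =>
    hα.mono (hβ.nonneg hs hb) (hβ.antitoneOn s hs ha hb hab)
  tendsto_zero s hs := by
    have h0 : Filter.Tendsto α (nhdsWithin 0 (Ici 0)) (nhds 0) := by
      simpa [ContinuousWithinAt, hα.map_zero] using hα.continuousOn 0 self_mem_Ici
    refine h0.comp (tendsto_nhdsWithin_iff.2 ⟨hβ.tendsto_zero s hs, ?_⟩)
    filter_upwards [Filter.eventually_ge_atTop 0] with t ht using hβ.nonneg hs ht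

/-- A continuous function vanishing at the origin is dominated by a class `K_∞` function of the
norm. -/
theorem exists_classKInf_forall_le {E : Type*} [NormedAddCommGroup E] [NormedSpace ℝ E]
    [ProperSpace E] {F : E → ℝ} (hF : Continuous F) (h0 : F 0 = 0) :
    ∃ α : ℝ → ℝ, ClassKInf α ∧ ∀ x, F x ≤ α ‖x‖ := by
  have hK : IsCompact (Metric.closedBall (0 : E) 1) := isCompact_closedBall _ _
  have hcont : Continuous (fun p : ℝ × E => F (p.1 • p.2)) := by fun_prop
  -- The maximum of `F` over the ball of radius `s`, parametrized by the fixed unit ball so that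
  -- compactness gives continuity in `s`.
  set A : ℝ → ℝ := fun s => sSup ((fun z => F (s • z)) '' Metric.closedBall (0 : E) 1) with hA
  have hAc : Continuous A := hK.continuous_sSup (f := fun s z => F (s • z)) hcont
  have hbdd : ∀ s : ℝ, BddAbove ((fun z => F (s • z)) '' Metric.closedBall (0 : E) 1) := fun s =>
    (hK.image (by fun_prop)).bddAbove
  have hle : ∀ (s : ℝ) (x : E), 0 ≤ s → ‖x‖ ≤ s → F x ≤ A s := by
    intro s x hs hx
    rcases hs.eq_or_lt with rfl | hs
    · rw [norm_le_zero_iff.1 hx]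
      exact le_csSup (hbdd 0) ⟨0, by simp⟩
    · refine le_csSup (hbdd s) ⟨s⁻¹ • x, ?_, ?_⟩
      · rw [mem_closedBall_zero_iff, norm_smul, norm_inv, Real.norm_of_nonneg hs.le,
          inv_mul_le_iff₀ hs]
        simpa using hx
      · simp [smul_smul, hs.ne']
  have hmono : MonotoneOn A (Ici 0) := by
    intro a ha b hb hab
    refine csSup_le ⟨_, mem_image_of_mem _ (Metric.mem_closedBall_self zero_le_one)⟩ ?_
    rintro _ ⟨z, hz, rfl⟩
    refine hle b _ hb ?_
    rw [norm_smul, Real.norm_of_nonneg ha]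
    exact (mul_le_of_le_one_right ha (mem_closedBall_zero_iff.1 hz)).trans hab
  have hA0 : A 0 = 0 := by
    have : (fun z : E => F ((0 : ℝ) • z)) = fun _ => 0 := by ext z; simp [h0]
    simp only [hA, this]
    rw [Set.Nonempty.image_const (Metric.nonempty_closedBall.2 zero_le_one), csSup_singleton]
  have hAnn : ∀ s, 0 ≤ s → 0 ≤ A s := fun s hs => hA0 ▸ hmono self_mem_Ici hs hs
  -- The summand `s` makes the monotone function `A` strictly increasing and unbounded.
  refine ⟨fun s => A s + s, ⟨⟨(by fun_prop), fun a ha b hb hab =>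
    add_lt_add_of_le_of_lt (hmono ha hb hab.le) hab, by simp [hA0]⟩, fun M => ?_⟩, fun x => ?_⟩
  · refine ⟨|M| + 1, by positivity, ?_⟩
    have := hAnn (|M| + 1) (by positivity)
    have := le_abs_self M
    linarith
  · exact (hle _ x (norm_nonneg x) le_rfl).trans (le_add_of_nonneg_right (norm_nonneg x))

/-! ### Norms of stacked signals -/

theorem norm_toLp_prod_le {E : Type*} [NormedAddCommGroup E] (a : ℝ) (x : E) :
    ‖WithLp.toLp 2 (a, x)‖ ≤ |a| + ‖x‖ := by
  rw [WithLp.prod_norm_eq_of_L2]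
  refine Real.sqrt_le_iff.2 ⟨by positivity, ?_⟩
  simp only [Real.norm_eq_abs, WithLp.toLp_fst, WithLp.toLp_snd]
  nlinarith [mul_nonneg (abs_nonneg a) (norm_nonneg x)]

theorem abs_le_norm_toLp_prod {E : Type*} [NormedAddCommGroup E] (a : ℝ) (x : E) :
    |a| ≤ ‖WithLp.toLp 2 (a, x)‖ := by
  rw [WithLp.prod_norm_eq_of_L2]
  refine Real.le_sqrt_of_sq_le ?_
  simp only [Real.norm_eq_abs, WithLp.toLp_fst, WithLp.toLp_snd]
  nlinarith [sq_nonneg ‖x‖]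

theorem norm_le_norm_toLp_prod {E : Type*} [NormedAddCommGroup E] (a : ℝ) (x : E) :
    ‖x‖ ≤ ‖WithLp.toLp 2 (a, x)‖ := by
  rw [WithLp.prod_norm_eq_of_L2]
  refine Real.le_sqrt_of_sq_le ?_
  simp only [WithLp.toLp_fst, WithLp.toLp_snd]
  nlinarith [sq_nonneg ‖a‖]

theorem EuclideanSpace.norm_toLp_le_sum {ι : Type*} [Fintype ι] (a : ι → ℝ) :
    ‖(WithLp.toLp 2 a : EuclideanSpace ℝ ι)‖ ≤ ∑ i, |a i| := by
  rw [EuclideanSpace.norm_eq]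
  refine Real.sqrt_le_iff.2 ⟨Finset.sum_nonneg fun _ _ => abs_nonneg _, ?_⟩
  exact Finset.sum_sq_le_sq_sum_of_nonneg fun _ _ => abs_nonneg _

theorem EuclideanSpace.norm_toLp_le_of_le {k N : ℕ} (hkN : k ≤ N) (a : ℕ → ℝ) :
    ‖(WithLp.toLp 2 (fun i : Fin (k + 1) => a i) : EuclideanSpace ℝ (Fin (k + 1)))‖ ≤
      ‖(WithLp.toLp 2 (fun i : Fin (N + 1) => a i) : EuclideanSpace ℝ (Fin (N + 1)))‖ := by
  rw [EuclideanSpace.norm_eq, EuclideanSpace.norm_eq]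
  refine Real.sqrt_le_sqrt ?_
  simp only [Fin.sum_univ_eq_sum_range (fun i => ‖a i‖ ^ 2)]
  exact Finset.sum_le_sum_of_subset_of_nonneg (Finset.range_mono (by omega))
    fun _ _ _ => by positivity

theorem supNorm_nonneg {F : Type*} [NormedAddCommGroup F] (z : ℝ → F) (t : ℝ) :
    0 ≤ supNorm z t :=
  Real.sSup_nonneg (by rintro _ ⟨s, -, rfl⟩; exact norm_nonneg _)

theorem supNorm_congr {F : Type*} [NormedAddCommGroup F] {z w : ℝ → F} {t : ℝ}
    (hzw : EqOn z w (Icc 0 t)) : supNorm z t = supNorm w t := by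
  unfold supNorm
  congr 1
  exact image_congr fun s hs => by rw [hzw hs]

/-- Continuity guarantees boundedness; on an unbounded set `sSup` would default to `0`. -/
theorem norm_le_supNorm {F : Type*} [NormedAddCommGroup F] {z : ℝ → F} {t s : ℝ}
    (hz : ContinuousOn z (Icc 0 t)) (hs : s ∈ Icc 0 t) : ‖z s‖ ≤ supNorm z t :=
  le_csSup (isCompact_Icc.image_of_continuousOn hz.norm).bddAbove (mem_image_of_mem _ hs)

theorem supNorm_le_supNorm {F G : Type*} [NormedAddCommGroup F] [NormedAddCommGroup G]
    {z : ℝ → F} {w : ℝ → G} {t : ℝ} (hw : ContinuousOn w (Icc 0 t))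
    (hzw : ∀ s ∈ Icc 0 t, ‖z s‖ ≤ ‖w s‖) : supNorm z t ≤ supNorm w t :=
  Real.sSup_le (by
    rintro _ ⟨s, hs, rfl⟩
    exact (hzw s hs).trans (norm_le_supNorm hw hs)) (supNorm_nonneg w t)

theorem supNorm_zero_right {F : Type*} [NormedAddCommGroup F] (z : ℝ → F) :
    supNorm z 0 = ‖z 0‖ := by
  simp [supNorm]

/-! ### Smoothness of the functions `H_k` -/

section OutputDerivatives

variable {n : ℕ} {f : EuclideanSpace ℝ (Fin n) → ℝ → EuclideanSpace ℝ (Fin n)}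
  {h : EuclideanSpace ℝ (Fin n) → ℝ}

theorem contDiff_outputH (hf : ContDiff ℝ ∞ (fun p : EuclideanSpace ℝ (Fin n) × ℝ => f p.1 p.2))
    (hh : ContDiff ℝ ∞ h) (k : ℕ) :
    ContDiff ℝ ∞ (fun p : EuclideanSpace ℝ (Fin n) × (Fin k → ℝ) => outputH f h k p.1 p.2) := by
  induction k with
  | zero => exact hh.comp contDiff_fst
  | succ k ih =>
    have hinit : ContDiff ℝ ∞ (fun p : EuclideanSpace ℝ (Fin n) × (Fin (k + 1) → ℝ) =>
        (fun i : Fin k => p.2 i.castSucc)) := by fun_prop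
    simp only [outputH]
    refine ContDiff.add ?_ (ContDiff.sum fun j _ => ContDiff.mul ?_ (by fun_prop))
    · refine ContDiff.fderiv_apply (m := ∞) (f := fun (p : EuclideanSpace ℝ (Fin n) ×
        (Fin (k + 1) → ℝ)) z => outputH f h k z (fun i => p.2 i.castSucc)) ?_ contDiff_fst ?_
        (by simp)
      · exact ih.comp (contDiff_snd.prodMk (hinit.comp contDiff_fst))
      · exact hf.comp (contDiff_fst.prodMk (by fun_prop))
    · refine ContDiff.fderiv_apply (m := ∞) (f := fun (p : EuclideanSpace ℝ (Fin n) ×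
        (Fin (k + 1) → ℝ)) w => outputH f h k p.1 w) ?_ hinit contDiff_const (by simp)
      exact ih.comp ((contDiff_fst.comp contDiff_fst).prodMk contDiff_snd)

theorem fderiv_prod_apply {E F G : Type*} [NormedAddCommGroup E] [NormedSpace ℝ E]
    [NormedAddCommGroup F] [NormedSpace ℝ F] [NormedAddCommGroup G] [NormedSpace ℝ G]
    {H : E × F → G} {x : E} {v : F} (hH : DifferentiableAt ℝ H (x, v)) (a : E) (b : F) :
    fderiv ℝ H (x, v) (a, b) =
      fderiv ℝ (fun z => H (z, v)) x a + fderiv ℝ (fun w => H (x, w)) v b := by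
  have h1 : HasFDerivAt (fun z => H (z, v)) _ x :=
    hH.hasFDerivAt.comp x (hasFDerivAt_prodMk_left x v)
  have h2 : HasFDerivAt (fun w => H (x, w)) _ v :=
    hH.hasFDerivAt.comp v (hasFDerivAt_prodMk_right x v)
  rw [h1.fderiv, h2.fderiv]
  simp [← map_add]

/-- The recursion defining `H_{k+1}` computes the derivative of `H_k` along a trajectory. -/
theorem hasDerivWithinAt_outputH
    (hf : ContDiff ℝ ∞ (fun p : EuclideanSpace ℝ (Fin n) × ℝ => f p.1 p.2))
    (hh : ContDiff ℝ ∞ h) {k : ℕ} {x : ℝ → EuclideanSpace ℝ (Fin n)} {v : ℕ → ℝ → ℝ}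
    {J : Set ℝ} {t : ℝ} (hx : HasDerivWithinAt x (f (x t) (v 0 t)) J t)
    (hv : ∀ i < k, HasDerivWithinAt (v i) (v (i + 1) t) J t) :
    HasDerivWithinAt (fun s => outputH f h k (x s) (fun i => v i s))
      (outputH f h (k + 1) (x t) (fun i => v i t)) J t := by
  have hH := (contDiff_outputH hf hh k).differentiable (by simp) (x t, fun i : Fin k => v i t)
  have hv' : HasDerivWithinAt (fun s => (fun i : Fin k => v i s))
      (fun i : Fin k => v (i + 1) t) J t :=
    hasDerivWithinAt_pi.2 fun i => hv i i.2
  have key := hH.hasFDerivAt.comp_hasDerivWithinAt t (hx.prodMk hv')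
  have hval : fderiv ℝ (fun p : EuclideanSpace ℝ (Fin n) × (Fin k → ℝ) => outputH f h k p.1 p.2)
      (x t, fun i => v i t) (f (x t) (v 0 t), fun i => v (i + 1) t) =
      outputH f h (k + 1) (x t) (fun i => v i t) := by
    rw [fderiv_prod_apply hH]
    simp only [outputH, Fin.val_castSucc, Fin.val_succ, Fin.val_zero]
    congr 1
    -- Expanding the direction `(u₁, …, u_k)` in the standard basis produces the sum over
    -- `∂H_k/∂u_j`.
    conv_lhs => rw [pi_eq_sum_univ' (fun i : Fin k => v (i + 1) t)]
    rw [map_sum]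
    refine Finset.sum_congr rfl fun j _ => ?_
    rw [map_smul, smul_eq_mul, mul_comm]
  rw [hval] at key
  exact key

/-! ### Trajectories -/

/-- Localizes `[0, T)`, with `T` possibly infinite, to a compact interval that is a neighbourhood of
`t` within it. -/
theorem timeDomain_mem_nhdsGE {T : EReal} {t : ℝ} (ht : t ∈ timeDomain T) :
    ∃ b, t < b ∧ Icc 0 b ⊆ timeDomain T ∧ timeDomain T ∩ Iio b ⊆ Icc 0 b := by
  obtain ⟨b, hb1, hb2⟩ := EReal.exists_between_coe_real ht.2
  refine ⟨b, EReal.coe_lt_coe_iff.1 hb1, fun s hs => ⟨hs.1, ?_⟩, fun s hs => ⟨hs.1.1, hs.2.le⟩⟩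
  exact (EReal.coe_le_coe_iff.2 hs.2).trans_lt hb2

theorem Icc_subset_timeDomain {T : EReal} {t : ℝ} (ht : t ∈ timeDomain T) :
    Icc 0 t ⊆ timeDomain T := fun _ hs =>
  ⟨hs.1, (EReal.coe_le_coe_iff.2 hs.2).trans_lt ht.2⟩

theorem timeDomain_subset_Ici (T : EReal) : timeDomain T ⊆ Ici 0 := fun _ hs => hs.1

theorem uniqueDiffOn_timeDomain (T : EReal) : UniqueDiffOn ℝ (timeDomain T) := by
  intro t ht
  obtain ⟨b, htb, hb, -⟩ := timeDomain_mem_nhdsGE ht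
  exact (uniqueDiffOn_Icc (ht.1.trans_lt htb) t ⟨ht.1, htb.le⟩).mono hb

/-- For a continuous input, the solutions are classical ones. -/
theorem IsSolution.hasDerivWithinAt
    (hf : ContDiff ℝ ∞ (fun p : EuclideanSpace ℝ (Fin n) × ℝ => f p.1 p.2))
    {u : ℝ → ℝ} {T : EReal} {x : ℝ → EuclideanSpace ℝ (Fin n)} (hx : IsSolution f u T x)
    (hu : ContinuousOn u (Ici 0)) {t : ℝ} (ht : t ∈ timeDomain T) :
    HasDerivWithinAt x (f (x t) (u t)) (timeDomain T) t := by
  obtain ⟨b, htb, hb, hb'⟩ := timeDomain_mem_nhdsGE ht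
  have hb0 : 0 ≤ b := ht.1.trans htb.le
  have htm : t ∈ Icc 0 b := ⟨ht.1, htb.le⟩
  have hg : ContinuousOn (fun s => f (x s) (u s)) (Icc 0 b) :=
    hf.continuous.comp_continuousOn ((hx.continuousOn.mono hb).prodMk
      (hu.mono fun s hs => hs.1))
  -- Extending the integrand by constants makes it continuous on the whole line, so the two-sided
  -- fundamental theorem of calculus applies even at `t = 0`.
  set G : ℝ → EuclideanSpace ℝ (Fin n) := IccExtend hb0 (domRestrict (Icc 0 b) fun s => f (x s) (u s))
    with hG
  have hGc : Continuous G := (continuousOn_iff_continuous_domRestrict.1 hg).Icc_extend'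
  have hGeq : ∀ s ∈ Icc 0 b, G s = f (x s) (u s) := fun s hs => by
    rw [hG, IccExtend_of_mem _ _ hs]; rfl
  have hxeq : ∀ s ∈ Icc 0 b, x s = x 0 + ∫ τ in (0 : ℝ)..s, G τ := fun s hs => by
    rw [hx.integral_eq s (hb hs)]
    congr 1
    refine intervalIntegral.integral_congr fun τ hτ => ?_
    rw [uIcc_of_le hs.1] at hτ
    exact (hGeq τ ⟨hτ.1, hτ.2.trans hs.2⟩).symm
  have hd : HasDerivAt (fun s => x 0 + ∫ τ in (0 : ℝ)..s, G τ) (G t) t :=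
    (hGc.integral_hasStrictDerivAt 0 t).hasDerivAt.const_add _
  rw [hGeq t htm] at hd
  have hd' : HasDerivWithinAt x (f (x t) (u t)) (Icc 0 b) t :=
    hd.hasDerivWithinAt.congr hxeq (hxeq t htm)
  refine hd'.mono_of_mem_nhdsWithin ?_
  exact Filter.mem_of_superset (inter_mem_nhdsWithin _ (Iio_mem_nhds htb)) hb'

theorem hasDerivWithinAt_iteratedDerivWithin_input {m : ℕ} {u : ℝ → ℝ}
    (hu : ContDiffOn ℝ m u (Ici 0)) {i : ℕ} (hi : i < m) {t : ℝ} (ht : 0 ≤ t) :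
    HasDerivWithinAt (iteratedDerivWithin i u (Ici 0)) (iteratedDerivWithin (i + 1) u (Ici 0) t)
      (Ici 0) t := by
  rw [iteratedDerivWithin_succ]
  exact (hu.differentiableOn_iteratedDerivWithin (by exact_mod_cast hi) (uniqueDiffOn_Ici 0) t
    ht).hasDerivWithinAt

/-- Each differentiation along the trajectory is one step of the recursion. Since `H_k` involves
input derivatives only up to order `k - 1`, a `C^m` input allows `m + 1` output derivatives. -/
theorem iteratedDerivWithin_output
    (hf : ContDiff ℝ ∞ (fun p : EuclideanSpace ℝ (Fin n) × ℝ => f p.1 p.2))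
    (hh : ContDiff ℝ ∞ h) {m : ℕ} {u : ℝ → ℝ} (hu : ContDiffOn ℝ m u (Ici 0))
    {T : EReal} {x : ℝ → EuclideanSpace ℝ (Fin n)} (hx : IsSolution f u T x) {k : ℕ}
    (hk : k ≤ m + 1) {t : ℝ} (ht : t ∈ timeDomain T) :
    iteratedDerivWithin k (fun s => h (x s)) (timeDomain T) t =
      outputH f h k (x t) (fun i => iteratedDerivWithin i u (Ici 0) t) := by
  induction k generalizing t with
  | zero => simp [outputH]
  | succ k ih =>
    rw [iteratedDerivWithin_succ,
      derivWithin_congr (fun s hs => ih (by omega) hs) (ih (by omega) ht)]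
    refine (hasDerivWithinAt_outputH hf hh (v := fun i => iteratedDerivWithin i u (Ici 0)) ?_
      fun i hi => ?_).derivWithin (uniqueDiffOn_timeDomain T t ht)
    · simpa using hx.hasDerivWithinAt hf hu.continuousOn ht
    · exact (hasDerivWithinAt_iteratedDerivWithin_input hu (by omega) ht.1).mono
        (timeDomain_subset_Ici T)

theorem derivStack_output_eq
    (hf : ContDiff ℝ ∞ (fun p : EuclideanSpace ℝ (Fin n) × ℝ => f p.1 p.2))
    (hh : ContDiff ℝ ∞ h) {m : ℕ} {u : ℝ → ℝ} (hu : ContDiffOn ℝ m u (Ici 0))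
    {T : EReal} {x : ℝ → EuclideanSpace ℝ (Fin n)} (hx : IsSolution f u T x)
    {t : ℝ} (ht : t ∈ timeDomain T) :
    derivStack (fun s => h (x s)) (timeDomain T) (m + 1) t = extendedOutput f h (m + 1) x u t := by
  unfold derivStack extendedOutput
  congr 1
  ext j
  exact iteratedDerivWithin_output hf hh hu hx (by omega) ht

theorem continuousOn_extendedOutput
    (hf : ContDiff ℝ ∞ (fun p : EuclideanSpace ℝ (Fin n) × ℝ => f p.1 p.2))
    (hh : ContDiff ℝ ∞ h) {m : ℕ} {u : ℝ → ℝ} (hu : ContDiffOn ℝ m u (Ici 0))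
    {T : EReal} {x : ℝ → EuclideanSpace ℝ (Fin n)} (hx : IsSolution f u T x) :
    ContinuousOn (extendedOutput f h (m + 1) x u) (timeDomain T) := by
  refine (PiLp.continuous_toLp 2 _).comp_continuousOn (continuousOn_pi.2 fun j => ?_)
  refine (contDiff_outputH hf hh j).continuous.comp_continuousOn
    (hx.continuousOn.prodMk (continuousOn_pi.2 fun i => ?_))
  exact (hu.continuousOn_iteratedDerivWithin (by exact_mod_cast (by omega : (i : ℕ) ≤ m))
    (uniqueDiffOn_Ici 0)).mono (timeDomain_subset_Ici T)

theorem ContinuousOn.isAdmissibleInput {u : ℝ → ℝ} (hu : ContinuousOn u (Ici 0)) :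
    IsAdmissibleInput u where
  aemeasurable := hu.aemeasurable measurableSet_Ici
  locally_essentially_bounded b := by
    obtain ⟨M, hM⟩ := isCompact_Icc.exists_bound_of_continuousOn
      (hu.mono (Icc_subset_Ici_self : Icc 0 b ⊆ Ici 0))
    exact ⟨M, (ae_restrict_iff' measurableSet_Icc).2 (Filter.Eventually.of_forall hM)⟩

theorem ContDiffOn.inputClass {m k : ℕ} {u : ℝ → ℝ} (hu : ContDiffOn ℝ m u (Ici 0))
    (hk : k ≤ m + 1) : InputClass k u := by
  cases k with
  | zero => exact hu.continuousOn.isAdmissibleInput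
  | succ k => exact hu.of_le (by exact_mod_cast (by omega : k ≤ m))

/-! ### Detectability and output-input stability -/

theorem HasRelativeDegree.outputInputStable
    (hf : ContDiff ℝ ∞ (fun p : EuclideanSpace ℝ (Fin n) × ℝ => f p.1 p.2))
    (hh : ContDiff ℝ ∞ h) {r k : ℕ} (hr : HasRelativeDegree f h r)
    (hk : WeaklyUniformlyZeroDetectable f h k) : OutputInputStable f h (max r k) := by
  obtain ⟨hr0, -, ρ₁, ρ₂, hρ₁, hρ₂, hρ⟩ := hr
  obtain ⟨β, γ, hβ, hγ, hdet⟩ := hk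
  -- The terms `ρ₁ (2 * ·)` come from splitting `ρ₁ (β + γ)`; the plain `β` and `γ` bound the state
  -- itself.
  refine ⟨lt_max_of_lt_left hr0, fun s t => β s t + ρ₁ (2 * β s t),
    fun s => (γ s + ρ₁ (2 * γ s)) + ρ₂ s, hβ.add (hρ₁.classK.comp_two_mul.comp_classKL hβ),
    (hγ.classK.add (hρ₁.classK.comp_two_mul.comp hγ.classK)).add_classKInf hρ₂, ?_⟩
  intro u T x hu hx t ht
  obtain ⟨m, hm⟩ : ∃ m, max r k = m + 1 := Nat.exists_eq_add_one.2 (lt_max_of_lt_left hr0)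
  rw [hm] at hu ⊢
  have hu : ContDiffOn ℝ m u (Ici 0) := hu
  have hrm : r ≤ m + 1 := by omega
  have hkm : k ≤ m + 1 := by omega
  have hsub := Icc_subset_timeDomain ht
  have hcont := (continuousOn_extendedOutput hf hh hu hx).mono hsub
  rw [supNorm_congr fun s hs => derivStack_output_eq hf hh hu hx (hsub hs)]
  set Y := supNorm (extendedOutput f h (m + 1) x u) t with hY
  have hY0 : 0 ≤ Y := supNorm_nonneg _ _
  have hkY : supNorm (extendedOutput f h k x u) t ≤ Y :=
    supNorm_le_supNorm hcont fun s _ => EuclideanSpace.norm_toLp_le_of_le hkm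
      (fun j => outputH f h j (x s) (fun i => iteratedDerivWithin i u (Ici 0) s))
  have hHr : |outputH f h r (x t) (fun i => iteratedDerivWithin i u (Ici 0) t)| ≤ Y :=
    (PiLp.norm_apply_le (extendedOutput f h (m + 1) x u t) ⟨r, by omega⟩).trans
      (norm_le_supNorm hcont (right_mem_Icc.2 ht.1))
  have hβ0 : 0 ≤ β ‖x 0‖ t := hβ.nonneg (norm_nonneg _) ht.1
  have hγ0 : 0 ≤ γ Y := hγ.classK.nonneg hY0
  have hxt : ‖x t‖ ≤ β ‖x 0‖ t + γ Y :=
    (hdet u T x (hu.inputClass hkm) hx t ht).trans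
      (add_le_add_right (hγ.classK.mono (supNorm_nonneg _ _) hkY) _)
  have hut := hρ (x t) (fun i => iteratedDerivWithin i u (Ici 0) t)
  simp only [iteratedDerivWithin_zero] at hut
  have h1 := (hρ₁.classK.mono (norm_nonneg _) hxt).trans (hρ₁.classK.apply_add_le hβ0 hγ0)
  have h2 := hρ₂.classK.mono (abs_nonneg _) hHr
  have h3 := norm_toLp_prod_le (u t) (x t)
  linarith

theorem OutputInputStable.weaklyUniformlyZeroDetectable
    (hf : ContDiff ℝ ∞ (fun p : EuclideanSpace ℝ (Fin n) × ℝ => f p.1 p.2))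
    (hh : ContDiff ℝ ∞ h) {N : ℕ} (hN : OutputInputStable f h N) :
    WeaklyUniformlyZeroDetectable f h N := by
  obtain ⟨hN0, β, γ, hβ, hγ, hstab⟩ := hN
  obtain ⟨m, rfl⟩ := Nat.exists_eq_add_one.2 hN0
  refine ⟨β, γ, hβ, hγ, fun u T x hu hx t ht => ?_⟩
  rw [← supNorm_congr fun s hs =>
    derivStack_output_eq hf hh hu hx (Icc_subset_timeDomain ht hs)]
  exact (norm_le_norm_toLp_prod _ _).trans (hstab u T x hu hx t ht)

end OutputDerivatives

section Jets

variable {n : ℕ} {f : EuclideanSpace ℝ (Fin n) → ℝ → EuclideanSpace ℝ (Fin n)}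
  {h : EuclideanSpace ℝ (Fin n) → ℝ}

/-! ### Realization of input jets at time zero -/

theorem Polynomial.iteratedDeriv_eval (p : Polynomial ℝ) (k : ℕ) :
    iteratedDeriv k (fun t => p.eval t) =
      fun t => ((Polynomial.derivative)^[k] p).eval t := by
  induction k with
  | zero => simp
  | succ k ih =>
    ext t
    rw [iteratedDeriv_succ, ih, Function.iterate_succ_apply', Polynomial.deriv]

theorem exists_contDiff_iteratedDerivWithin_eq (v : ℕ → ℝ) (N : ℕ) :
    ∃ u : ℝ → ℝ, ContDiff ℝ ∞ u ∧ ∀ i < N, iteratedDerivWithin i u (Ici 0) 0 = v i := by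
  -- The Taylor polynomial with the prescribed jet at zero.
  set p : Polynomial ℝ := ∑ i ∈ Finset.range N, Polynomial.monomial i (v i / i.factorial) with hp
  have hsm : ContDiff ℝ ∞ (fun t => p.eval t) := by simpa using p.contDiff_aeval (𝕜 := ℝ) ∞
  refine ⟨fun t => p.eval t, hsm, fun i hi => ?_⟩
  rw [iteratedDerivWithin_eq_iteratedDeriv (uniqueDiffOn_Ici 0)
    (hsm.contDiffAt.of_le (by exact_mod_cast le_top)) self_mem_Ici, Polynomial.iteratedDeriv_eval]
  dsimp only
  rw [← Polynomial.coeff_zero_eq_eval_zero, Polynomial.coeff_iterate_derivative, zero_add,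
    Nat.descFactorial_self, hp, Polynomial.finsetSum_coeff]
  simp only [Polynomial.coeff_monomial]
  rw [Finset.sum_ite_eq' (Finset.range N) i, if_pos (Finset.mem_range.2 hi), nsmul_eq_mul]
  field_simp

/-- Time is adjoined as a state with derivative `1`, which makes the equation autonomous, and the
local existence theorem for `C^1` vector fields applies. -/
theorem exists_isSolution
    (hf : ContDiff ℝ ∞ (fun p : EuclideanSpace ℝ (Fin n) × ℝ => f p.1 p.2)) {u : ℝ → ℝ}
    (hu : ContDiff ℝ ∞ u) (x₀ : EuclideanSpace ℝ (Fin n)) :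
    ∃ ε > (0 : ℝ), ∃ x : ℝ → EuclideanSpace ℝ (Fin n), x 0 = x₀ ∧ IsSolution f u (ε : ℝ) x := by
  set F : ℝ × EuclideanSpace ℝ (Fin n) → ℝ × EuclideanSpace ℝ (Fin n) :=
    fun p => (1, f p.2 (u p.1)) with hF
  have hFs : ContDiff ℝ ∞ F :=
    contDiff_const.prodMk (hf.comp (contDiff_snd.prodMk (hu.comp contDiff_fst)))
  obtain ⟨r, hr, ε, hε, hsol⟩ :=
    (hFs.contDiffAt (x := (0, x₀)).of_le
      (by simp)).exists_forall_mem_closedBall_exists_eq_forall_mem_Ioo_hasDerivAt 0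
  obtain ⟨z, hz0, hz⟩ := hsol (0, x₀) (Metric.mem_closedBall_self hr.le)
  simp only [zero_sub, zero_add] at hz
  have hz1 : ∀ t ∈ Ioo (-ε) ε, HasDerivAt (fun s => (z s).1) 1 t := fun t ht =>
    (hasFDerivAt_fst (p := z t)).comp_hasDerivAt t (hz t ht)
  have hz2 : ∀ t ∈ Ioo (-ε) ε, HasDerivAt (fun s => (z s).2) (f (z t).2 (u (z t).1)) t :=
    fun t ht => (hasFDerivAt_snd (p := z t)).comp_hasDerivAt t (hz t ht)
  have hsub : ∀ t, 0 ≤ t → t < ε → uIcc 0 t ⊆ Ioo (-ε) ε := fun t ht htε s hs => by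
    rw [uIcc_of_le ht] at hs
    exact ⟨by linarith [hs.1], by linarith [hs.2]⟩
  have htime : ∀ t, 0 ≤ t → t < ε → (z t).1 = t := fun t ht htε => by
    have := intervalIntegral.integral_eq_sub_of_hasDerivAt
      (fun s hs => hz1 s (hsub t ht htε hs)) intervalIntegrable_const
    simpa [hz0] using this.symm
  have hcont : ContinuousOn (fun s => (z s).2) (timeDomain (ε : ℝ)) := fun t ht =>
    (hz2 t ⟨by linarith [ht.1], EReal.coe_lt_coe_iff.1 ht.2⟩).continuousAt.continuousWithinAt
  have hint : ∀ t ∈ timeDomain (ε : ℝ),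
      IntervalIntegrable (fun s => f (z s).2 (u s)) volume 0 t := fun t ht => by
    refine ContinuousOn.intervalIntegrable ?_
    rw [uIcc_of_le ht.1]
    exact hf.continuous.comp_continuousOn
      ((hcont.mono (Icc_subset_timeDomain ht)).prodMk hu.continuous.continuousOn)
  refine ⟨ε, hε, fun t => (z t).2, by simp [hz0], hcont, hint, fun t ht => ?_⟩
  have htε : t < ε := EReal.coe_lt_coe_iff.1 ht.2
  rw [intervalIntegral.integral_eq_sub_of_hasDerivAt (f := fun s => (z s).2) (fun s hs => ?_)
    (hint t ht)]
  · abel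
  · have hs' := hs
    rw [uIcc_of_le ht.1] at hs'
    have := hz2 s (hsub t ht.1 htε hs)
    rwa [htime s hs'.1 (hs'.2.trans_lt htε)] at this

/-- Output-input stability, read at time zero, bounds the input by the jet of the output. -/
theorem OutputInputStable.exists_abs_le
    (hf : ContDiff ℝ ∞ (fun p : EuclideanSpace ℝ (Fin n) × ℝ => f p.1 p.2))
    (hh : ContDiff ℝ ∞ h) {N : ℕ} (hN : OutputInputStable f h N) :
    ∃ β γ : ℝ → ℝ, ClassK β ∧ ClassKInf γ ∧
      ∀ (x : EuclideanSpace ℝ (Fin n)) (v : ℕ → ℝ),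
        |v 0| ≤ β ‖x‖ + γ (∑ j ∈ Finset.range (N + 1), |outputH f h j x (fun i => v i)|) := by
  obtain ⟨hN0, β, γ, hβ, hγ, hstab⟩ := hN
  obtain ⟨m, rfl⟩ := Nat.exists_eq_add_one.2 hN0
  refine ⟨fun s => β s 0, γ, hβ.classK 0 le_rfl, hγ, fun x₀ v => ?_⟩
  obtain ⟨u, hu, huv⟩ := exists_contDiff_iteratedDerivWithin_eq v (m + 1)
  obtain ⟨ε, hε, x, rfl, hx⟩ := exists_isSolution hf hu x₀
  have hum : ContDiffOn ℝ m u (Ici 0) := (hu.of_le (by exact_mod_cast le_top)).contDiffOn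
  have h0 : (0 : ℝ) ∈ timeDomain (ε : ℝ) := ⟨le_rfl, EReal.coe_lt_coe_iff.2 hε⟩
  have key := hstab u ε x hum hx 0 h0
  -- At `t = 0` the supremum is over one point, so only the jet at the initial time remains.
  rw [supNorm_zero_right, derivStack_output_eq hf hh hum hx h0] at key
  have hu0 : u 0 = v 0 := by simpa using huv 0 (by omega)
  rw [← hu0]
  refine ((abs_le_norm_toLp_prod _ _).trans key).trans (add_le_add_right ?_ _)
  refine hγ.classK.mono (norm_nonneg _) ((EuclideanSpace.norm_toLp_le_sum _).trans (le_of_eq ?_))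
  rw [← Fin.sum_univ_eq_sum_range (fun j => |outputH f h j (x 0) (fun i => v i)|)]
  refine Finset.sum_congr rfl fun j _ => ?_
  congr 2
  ext i
  exact huv i (by omega)

/-! ### The structure of the functions `H_k` beyond the first one that depends on the input -/

/-- Written along a line, a partial derivative visibly inherits any independence of variables from
the function. -/
theorem fderiv_single_eq_lineDeriv {k : ℕ} {F : (Fin k → ℝ) → ℝ} (hF : Differentiable ℝ F)
    (v : Fin k → ℝ) (j : Fin k) :
    fderiv ℝ F v (Pi.single j 1) = deriv (fun s : ℝ => F (v + s • Pi.single j 1)) 0 :=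
  (hF v).lineDeriv_eq_fderiv.symm

theorem differentiable_outputH_right
    (hf : ContDiff ℝ ∞ (fun p : EuclideanSpace ℝ (Fin n) × ℝ => f p.1 p.2))
    (hh : ContDiff ℝ ∞ h) (k : ℕ) (x : EuclideanSpace ℝ (Fin n)) :
    Differentiable ℝ (fun w => outputH f h k x w) :=
  ((contDiff_outputH hf hh k).comp (contDiff_const.prodMk contDiff_id)).differentiable (by simp)

/-- If `H_k` does not depend on the input variables, then `H_{k+1}` depends only on `u₀`. -/
theorem outputH_succ_eq_of_indep {m : ℕ}
    (hind : ∀ (x : EuclideanSpace ℝ (Fin n)) (v w : Fin m → ℝ),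
      outputH f h m x v = outputH f h m x w)
    (x : EuclideanSpace ℝ (Fin n)) (v : Fin (m + 1) → ℝ) :
    outputH f h (m + 1) x v = fderiv ℝ (fun z => outputH f h m z 0) x (f x (v 0)) := by
  have h1 : (fun z => outputH f h m z (fun i => v i.castSucc)) = fun z => outputH f h m z 0 :=
    funext fun z => hind z _ _
  have h2 : ∀ a b, fderiv ℝ (fun w => outputH f h m x w) a b = 0 := fun a b => by
    rw [show (fun w => outputH f h m x w) = fun _ => outputH f h m x 0 from
      funext fun w => hind x _ _]
    simp
  rw [outputH, h1]
  simp [h2]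

/-- If `H_k` depends only on `x, u₀, …, u_j`, then `H_{k+1}` is affine in `u_{j+1}` and does not
depend on the subsequent input variables. -/
theorem outputH_succ_sub
    (hf : ContDiff ℝ ∞ (fun p : EuclideanSpace ℝ (Fin n) × ℝ => f p.1 p.2))
    (hh : ContDiff ℝ ∞ h) {k j : ℕ} (hjk : j < k)
    (hdep : ∀ (x : EuclideanSpace ℝ (Fin n)) (v w : Fin k → ℝ),
      (∀ i : Fin k, (i : ℕ) ≤ j → v i = w i) → outputH f h k x v = outputH f h k x w)
    (x : EuclideanSpace ℝ (Fin n)) (v w : Fin (k + 1) → ℝ)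
    (hvw : ∀ i : Fin (k + 1), (i : ℕ) ≤ j → v i = w i) :
    outputH f h (k + 1) x v - outputH f h (k + 1) x w =
      fderiv ℝ (fun a => outputH f h k x a) (fun i => v i.castSucc) (Pi.single ⟨j, hjk⟩ 1) *
        (v ⟨j + 1, by omega⟩ - w ⟨j + 1, by omega⟩) := by
  have hD := differentiable_outputH_right hf hh k x
  have hcast : ∀ i : Fin k, (i : ℕ) ≤ j → v i.castSucc = w i.castSucc := fun i hi => hvw _ hi
  have h1 : (fun z => outputH f h k z (fun i => v i.castSucc)) =
      fun z => outputH f h k z (fun i => w i.castSucc) := funext fun z => hdep z _ _ hcast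
  have h2 : ∀ i : Fin k,
      fderiv ℝ (fun a => outputH f h k x a) (fun i => v i.castSucc) (Pi.single i 1) =
      fderiv ℝ (fun a => outputH f h k x a) (fun i => w i.castSucc) (Pi.single i 1) := fun i => by
    rw [fderiv_single_eq_lineDeriv hD, fderiv_single_eq_lineDeriv hD]
    congr 1
    ext s
    exact hdep x _ _ fun l hl => by simp [hcast l hl]
  have h3 : ∀ i : Fin k, j < i →
      fderiv ℝ (fun a => outputH f h k x a) (fun i => v i.castSucc) (Pi.single i 1) = 0 := by
    intro i hi
    rw [fderiv_single_eq_lineDeriv hD]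
    have : (fun s : ℝ => outputH f h k x ((fun i => v i.castSucc) + s • Pi.single i 1)) =
        fun _ => outputH f h k x (fun i => v i.castSucc) := by
      ext s
      refine hdep x _ _ fun l hl => ?_
      have hli : l ≠ i := by rintro rfl; omega
      simp [hli]
    rw [this, deriv_const]
  simp only [outputH]
  -- The `x`-derivative terms cancel. In the sum, indices below `j` cancel because `u_{i+1}` agrees,
  -- and those above `j` have zero partial derivative.
  rw [h1, hvw 0 (Nat.zero_le _), add_sub_add_left_eq_sub, ← Finset.sum_sub_distrib,
    Finset.sum_eq_single ⟨j, hjk⟩]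
  · rw [← h2, ← mul_sub]
    rfl
  · intro i _ hij
    rw [← h2, ← mul_sub]
    rcases lt_or_gt_of_ne (fun hc => hij (Fin.ext hc) : (i : ℕ) ≠ j) with hlt | hgt
    · rw [hvw i.succ (by simpa using hlt), sub_self, mul_zero]
    · rw [h3 i hgt, zero_mul]
  · simp

/-- If `H_{m+1}(x, u₀, …, u_m) = g(x, u₀)`, then `H_{m+1+j}` depends only on `x, u₀, …, u_j`, and
its derivative with respect to `u_j` is `∂g/∂u₀`. -/
theorem outputH_dependence
    (hf : ContDiff ℝ ∞ (fun p : EuclideanSpace ℝ (Fin n) × ℝ => f p.1 p.2))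
    (hh : ContDiff ℝ ∞ h) {m : ℕ} {g : EuclideanSpace ℝ (Fin n) → ℝ → ℝ}
    (hg : ∀ (x : EuclideanSpace ℝ (Fin n)) (v : Fin (m + 1) → ℝ),
      outputH f h (m + 1) x v = g x (v 0)) (j : ℕ) :
    (∀ (x : EuclideanSpace ℝ (Fin n)) (v w : Fin (m + 1 + j) → ℝ),
      (∀ i : Fin (m + 1 + j), (i : ℕ) ≤ j → v i = w i) →
        outputH f h (m + 1 + j) x v = outputH f h (m + 1 + j) x w) ∧
    ∀ (x : EuclideanSpace ℝ (Fin n)) (v : Fin (m + 1 + j) → ℝ),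
      fderiv ℝ (fun a => outputH f h (m + 1 + j) x a) v (Pi.single ⟨j, by omega⟩ 1) =
        deriv (g x) (v ⟨0, by omega⟩) := by
  induction j with
  | zero =>
    refine ⟨fun x v w hvw => ?_, fun x v => ?_⟩
    · exact (hg x v).trans ((congrArg (g x) (hvw 0 le_rfl)).trans (hg x w).symm)
    · rw [fderiv_single_eq_lineDeriv (differentiable_outputH_right hf hh _ x)]
      have : (fun s : ℝ => outputH f h (m + 1) x (v + s • Pi.single 0 1)) =
          fun s => g x (v 0 + s) := by
        ext s
        rw [hg]
        simp
      refine (congrArg (fun F => deriv F 0) this).trans ?_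
      rw [deriv_comp_const_add, add_zero]
      rfl
  | succ j ih =>
    obtain ⟨ih1, ih2⟩ := ih
    have hsub := outputH_succ_sub hf hh (k := m + 1 + j) (j := j) (by omega) ih1
    -- The slope of the next function in `u_{j+1}` is the previous slope in `u_j`, hence again
    -- `∂g/∂u₀`.
    simp only [ih2] at hsub
    refine ⟨fun x v w hvw => ?_, fun x v => ?_⟩
    · have := hsub x v w fun i hi => hvw i (by omega)
      rw [hvw ⟨j + 1, by omega⟩ le_rfl, sub_self, mul_zero] at this
      exact sub_eq_zero.1 this
    · rw [fderiv_single_eq_lineDeriv (differentiable_outputH_right hf hh _ x)]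
      have : (fun s : ℝ => outputH f h (m + 1 + (j + 1)) x
          (v + s • Pi.single ⟨j + 1, by omega⟩ 1)) = fun s =>
          outputH f h (m + 1 + (j + 1)) x v + deriv (g x) (v ⟨0, by omega⟩) * s := by
        ext s
        have h1 := hsub x (v + s • Pi.single ⟨j + 1, by omega⟩ 1) v fun i hi => by
          have hne : i ≠ ⟨j + 1, by omega⟩ := by
            intro hc
            simp [hc] at hi
          simp [hne]
        have h2 : (v + s • Pi.single ⟨j + 1, by omega⟩ 1 : Fin (m + 1 + j + 1) → ℝ)
            (Fin.castSucc ⟨0, by omega⟩) = v ⟨0, by omega⟩ := by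
          simp
        rw [h2] at h1
        simp only [Pi.add_apply, Pi.smul_apply, Pi.single_eq_same, smul_eq_mul, mul_one,
          add_sub_cancel_left] at h1
        exact (sub_eq_iff_eq_add'.1 h1)
      rw [this, deriv_const_add, deriv_const_mul_field, deriv_id'', mul_one]

/-- Where `∂g/∂u₀ ≠ 0`, the jet of the input can be chosen so that the derivatives of the output
following `H_{m+1} = g` vanish. -/
theorem exists_jet_outputH_eq_zero
    (hf : ContDiff ℝ ∞ (fun p : EuclideanSpace ℝ (Fin n) × ℝ => f p.1 p.2))
    (hh : ContDiff ℝ ∞ h) {m : ℕ} {g : EuclideanSpace ℝ (Fin n) → ℝ → ℝ}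
    (hg : ∀ (x : EuclideanSpace ℝ (Fin n)) (v : Fin (m + 1) → ℝ),
      outputH f h (m + 1) x v = g x (v 0))
    {x : EuclideanSpace ℝ (Fin n)} {s : ℝ} (hs : deriv (g x) s ≠ 0) (l : ℕ) :
    ∃ v : ℕ → ℝ, v 0 = s ∧ ∀ j < l, outputH f h (m + 1 + j + 1) x (fun i => v i) = 0 := by
  induction l with
  | zero => exact ⟨fun _ => s, rfl, by simp⟩
  | succ l ih =>
    obtain ⟨v, hv0, hv⟩ := ih
    -- The root of the affine equation in `u_{l+1}`. The equations already solved involve only `u₀,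
    -- …, u_l` and are undisturbed.
    set c := v (l + 1) - outputH f h (m + 1 + l + 1) x (fun i => v i) / deriv (g x) s with hc
    refine ⟨Function.update v (l + 1) c, by simp [hv0], fun j hj => ?_⟩
    rcases Nat.lt_succ_iff_lt_or_eq.1 hj with hj | rfl
    · rw [← hv j hj]
      refine (outputH_dependence hf hh hg (j + 1)).1 x _ _ fun i hi => ?_
      exact Function.update_of_ne (by omega) _ _
    · have hdep := outputH_dependence hf hh hg j
      have h1 := outputH_succ_sub hf hh (by omega) hdep.1 x
        (fun i => Function.update v (j + 1) c i) (fun i => v i)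
        fun i hi => Function.update_of_ne (by omega) _ _
      rw [hdep.2] at h1
      simp only [Function.update_self] at h1
      rw [show Function.update v (j + 1) c (Fin.castSucc ⟨0, by omega⟩ : Fin (m + 1 + j + 1)) = s by
        simp [hv0], hc] at h1
      have h2 : deriv (g x) s * (v (j + 1) - outputH f h (m + 1 + j + 1) x (fun i => v i) /
          deriv (g x) s - v (j + 1)) = - outputH f h (m + 1 + j + 1) x (fun i => v i) := by
        field_simp
        ring
      linarith

/-- Every term of the recursion carries a factor `f(0, 0)` or `u_{j+1}`, all zero here. -/
theorem outputH_zero_eq_zero (hf0 : f 0 0 = 0) (hh0 : h 0 = 0) (k : ℕ) :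
    outputH f h k 0 0 = 0 := by
  cases k with
  | zero => exact hh0
  | succ k => simp [outputH, hf0]

/-! ### Existence of a relative degree -/

/-- Identity theorem: the analytic derivative vanishes identically, making `φ` constant, or is
nonzero off a discrete set. -/
theorem dense_deriv_ne_zero {φ : ℝ → ℝ} (hφ : AnalyticOnNhd ℝ φ univ) {a b : ℝ}
    (hab : φ a ≠ φ b) : Dense {s | deriv φ s ≠ 0} := by
  rcases hφ.deriv.eqOn_zero_or_eventually_ne_zero_of_preconnected isPreconnected_univ with h0 | h0
  · exact absurd (is_const_of_deriv_eq_zero (fun s => (hφ s trivial).differentiableAt)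
      (fun s => h0 trivial) a b) hab
  · intro s
    rw [mem_closure_iff_frequently]
    have h1 : ∀ᶠ t in nhdsWithin s {s}ᶜ, deriv φ t ≠ 0 := by
      filter_upwards [Filter.disjoint_principal_right.1 (mem_codiscreteWithin.1 h0 s trivial)]
        with t ht
      simpa using ht
    exact h1.frequently.filter_mono nhdsWithin_le_nhds

/-- A bound `|s| ≤ B(x, g(x, s))` that holds wherever `∂g/∂s ≠ 0` holds everywhere, provided that
`g` is analytic in `s` and depends on `s` for some `x`. -/
theorem abs_le_of_deriv_ne_zero_imp {E : Type*} [TopologicalSpace E] [PreconnectedSpace E]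
    {g B : E → ℝ → ℝ} (hgc : Continuous (fun p : E × ℝ => g p.1 p.2))
    (hBc : Continuous (fun p : E × ℝ => B p.1 p.2)) (hgan : ∀ x, AnalyticOnNhd ℝ (g x) univ)
    (hloc : ∀ x s, deriv (g x) s ≠ 0 → |s| ≤ B x (g x s)) {x₁ : E} {a b : ℝ}
    (hne : g x₁ a ≠ g x₁ b) (x : E) (s : ℝ) : |s| ≤ B x (g x s) := by
  have hcomp : Continuous (fun p : E × ℝ => B p.1 (g p.1 p.2)) :=
    hBc.comp (continuous_fst.prodMk hgc)
  have hgx : ∀ s, Continuous (fun x => g x s) := fun s =>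
    hgc.comp (continuous_id.prodMk continuous_const)
  set V : Set E := {x | ∃ s, g x s ≠ g x 0} with hV
  -- The key equality: the left side is open and the right side closed. If `g(x, ·)` is nonconstant,
  -- density extends the bound to all `s`; if constant, the right-hand side of the bound is constant
  -- and cannot dominate `|s|`.
  have hVW : V = {x | ∀ s, |s| ≤ B x (g x s)} := by
    ext x
    constructor
    · rintro ⟨a, ha⟩ s
      have hcl : IsClosed {s : ℝ | |s| ≤ B x (g x s)} :=
        isClosed_le continuous_abs (hcomp.comp (continuous_const.prodMk continuous_id))
      exact hcl.closure_subset_iff.2 (fun s hs => hloc x s hs) (dense_deriv_ne_zero (hgan x) ha s)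
    · intro hx
      by_contra hc
      simp only [hV, mem_ofPred_eq, not_exists, not_not] at hc
      have h1 := hx (|B x (g x 0)| + 1)
      rw [hc (|B x (g x 0)| + 1)] at h1
      have h2 := le_abs_self (B x (g x 0))
      have h3 := le_abs_self (|B x (g x 0)| + 1)
      linarith
  have hVo : IsOpen V := by
    simp only [hV, ofPred_exists]
    exact isOpen_iUnion fun s => isOpen_ne_fun (hgx s) (hgx 0)
  have hVc : IsClosed V := by
    rw [hVW, ofPred_forall]
    exact isClosed_iInter fun s =>
      isClosed_le continuous_const (hcomp.comp (continuous_id.prodMk continuous_const))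
  have hVne : V.Nonempty := by
    refine ⟨x₁, ?_⟩
    by_contra hc
    simp only [hV, mem_ofPred_eq, not_exists, not_not] at hc
    exact hne (by rw [hc, hc b])
  have hx : x ∈ V := IsClopen.eq_univ ⟨hVc, hVo⟩ hVne ▸ mem_univ x
  rw [hVW] at hx
  exact hx s

theorem OutputInputStable.exists_hasRelativeDegree
    (hf : ContDiff ℝ ∞ (fun p : EuclideanSpace ℝ (Fin n) × ℝ => f p.1 p.2))
    (hh : ContDiff ℝ ∞ h) {N : ℕ} (hN : OutputInputStable f h N)
    (han : ∀ x : EuclideanSpace ℝ (Fin n), AnalyticOnNhd ℝ (fun u : ℝ => f x u) univ)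
    (hf0 : f 0 0 = 0) (hh0 : h 0 = 0) :
    ∃ r : ℕ, r ≤ N ∧ HasRelativeDegree f h r := by
  classical
  obtain ⟨β, γ, hβ, hγ, hbd⟩ := hN.exists_abs_le hf hh
  have hex : ∃ r, r ≤ N ∧ ∃ (x : EuclideanSpace ℝ (Fin n)) (v w : Fin r → ℝ),
      outputH f h r x v ≠ outputH f h r x w := by
    by_contra! hind
    set B := β ‖(0 : EuclideanSpace ℝ (Fin n))‖ +
      γ (∑ j ∈ Finset.range (N + 1), |outputH f h j 0 0|) with hB
    -- If no `H_j` saw the input, `B` would bound every `u₀` at the origin; this value exceeds it.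
    have h1 := hbd 0 (fun _ => |B| + 1)
    rw [Finset.sum_congr rfl fun j hj => by
      rw [hind j (Nat.lt_succ_iff.1 (Finset.mem_range.1 hj)) 0 _ 0], ← hB] at h1
    have h2 := le_abs_self B
    have h3 := le_abs_self (|B| + 1)
    linarith
  obtain ⟨r, ⟨hrN, x₁, v₁, w₁, hne⟩, hlt⟩ := (⟨Nat.find hex, Nat.find_spec hex,
    fun k hk => Nat.find_min hex hk⟩ : ∃ r, (r ≤ N ∧ ∃ (x : EuclideanSpace ℝ (Fin n))
      (v w : Fin r → ℝ), outputH f h r x v ≠ outputH f h r x w) ∧ ∀ k < r, ¬ (k ≤ N ∧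
      ∃ (x : EuclideanSpace ℝ (Fin n)) (v w : Fin k → ℝ),
        outputH f h k x v ≠ outputH f h k x w))
  have hmin : ∀ k < r, ∀ (x : EuclideanSpace ℝ (Fin n)) (v w : Fin k → ℝ),
      outputH f h k x v = outputH f h k x w := by
    intro k hk x v w
    by_contra hc
    exact hlt k hk ⟨hk.le.trans hrN, x, v, w, hc⟩
  obtain _ | m := r
  · exact absurd (congrArg _ (Subsingleton.elim v₁ w₁)) hne
  set g : EuclideanSpace ℝ (Fin n) → ℝ → ℝ :=
    fun x s => fderiv ℝ (fun z => outputH f h m z 0) x (f x s) with hgdef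
  have hg : ∀ (x : EuclideanSpace ℝ (Fin n)) (v : Fin (m + 1) → ℝ),
      outputH f h (m + 1) x v = g x (v 0) :=
    outputH_succ_eq_of_indep (hmin m m.lt_succ_self)
  have hgan : ∀ x, AnalyticOnNhd ℝ (g x) univ := fun x =>
    (fderiv ℝ (fun z => outputH f h m z 0) x).comp_analyticOnNhd (han x)
  have hgc : Continuous (fun p : EuclideanSpace ℝ (Fin n) × ℝ => g p.1 p.2) := by
    -- Evaluating `H_{m+1}` on constant jets exhibits `g` as jointly continuous.
    have := (contDiff_outputH hf hh (m + 1)).continuous.comp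
      (continuous_fst.prodMk (continuous_pi fun _ => continuous_snd) :
        Continuous fun p : EuclideanSpace ℝ (Fin n) × ℝ => (p.1, fun _ : Fin (m + 1) => p.2))
    simpa only [Function.comp_def, hg] using this
  set F : EuclideanSpace ℝ (Fin n) → ℝ :=
    fun x => ∑ j ∈ Finset.range (m + 1), |outputH f h j x 0| with hFdef
  have hFc : Continuous F := continuous_finsetSum _ fun j _ =>
    ((contDiff_outputH hf hh j).continuous.comp (continuous_id.prodMk continuous_const)).abs
  have hF0 : F 0 = 0 := by simp [hFdef, outputH_zero_eq_zero hf0 hh0]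
  have hFnn : ∀ x, 0 ≤ F x := fun x => Finset.sum_nonneg fun _ _ => abs_nonneg _
  have hloc : ∀ x s, deriv (g x) s ≠ 0 → |s| ≤ β ‖x‖ + γ (F x + |g x s|) := by
    intro x s hs
    -- Exactly `H_{m+2}, …, H_N` have to be annihilated.
    obtain ⟨v, rfl, hv⟩ := exists_jet_outputH_eq_zero hf hh hg hs (N - (m + 1))
    refine (hbd x v).trans (le_of_eq ?_)
    congr 2
    rw [show N + 1 = (m + 1 + 1) + (N - (m + 1)) by omega, Finset.sum_range_add,
      Finset.sum_range_succ, hg]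
    rw [Finset.sum_eq_zero (s := Finset.range (N - (m + 1))) fun j hj => ?_, add_zero]
    · congr 1
      exact Finset.sum_congr rfl fun j hj => by
        rw [hmin j (Finset.mem_range.1 hj) x _ 0]
    · have := hv j (Finset.mem_range.1 hj)
      rw [abs_eq_zero]
      have hidx : m + 1 + 1 + j = m + 1 + j + 1 := by omega
      rw [hidx, this]
  have hBc : Continuous (fun p : EuclideanSpace ℝ (Fin n) × ℝ =>
      β ‖p.1‖ + γ (F p.1 + |p.2|)) := by
    have h1 : Continuous (fun p : EuclideanSpace ℝ (Fin n) × ℝ => F p.1 + |p.2|) :=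
      (hFc.comp continuous_fst).add continuous_snd.abs
    have h2 : Continuous (fun p : EuclideanSpace ℝ (Fin n) × ℝ => ‖p.1‖) :=
      continuous_fst.norm
    exact (hβ.continuousOn.comp_continuous h2 fun p => norm_nonneg p.1).add
      (hγ.classK.continuousOn.comp_continuous h1 fun p => add_nonneg (hFnn _) (abs_nonneg _))
  have hglob := abs_le_of_deriv_ne_zero_imp (B := fun x c => β ‖x‖ + γ (F x + |c|)) hgc hBc
    hgan hloc (fun hc => hne (by rw [hg, hg, hc]))
  obtain ⟨α, hα, hFα⟩ := exists_classKInf_forall_le hFc hF0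
  -- From `γ(F + |g|) ≤ γ(2F) + γ(2|g|)` and `F ≤ α(‖x‖)`.
  refine ⟨m + 1, hrN, m.succ_pos, hmin, fun s => β s + γ (2 * α s), fun s => γ (2 * s),
    hβ.add_classKInf ?_, hγ.comp_two_mul, fun x v => ?_⟩
  · refine ⟨hγ.classK.comp_two_mul.comp hα.classK, fun M => ?_⟩
    obtain ⟨a, ha0, ha⟩ := hγ.unbounded M
    obtain ⟨s, hs0, hs⟩ := hα.unbounded a
    have := hα.classK.nonneg hs0
    exact ⟨s, hs0, ha.trans_le (hγ.classK.mono ha0 (by linarith))⟩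
  · have h1 := hglob x (v 0)
    have h2 := hγ.classK.apply_add_le (hFnn x) (abs_nonneg (g x (v 0)))
    have h3 := hγ.classK.mono (a := 2 * F x) (b := 2 * α ‖x‖) (by linarith [hFnn x])
      (by linarith [hFα x])
    rw [hg]
    change |v 0| ≤ _
    linarith

end Jets

theorem theorem1 {n : ℕ}
    (f : EuclideanSpace ℝ (Fin n) → ℝ → EuclideanSpace ℝ (Fin n))
    (h : EuclideanSpace ℝ (Fin n) → ℝ)
    (hf : ContDiff ℝ ∞ (fun p : EuclideanSpace ℝ (Fin n) × ℝ => f p.1 p.2))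
    (hh : ContDiff ℝ ∞ h) :
    (∀ r k : ℕ, HasRelativeDegree f h r → WeaklyUniformlyZeroDetectable f h k →
      OutputInputStable f h (max r k)) ∧
    (∀ N : ℕ, OutputInputStable f h N → WeaklyUniformlyZeroDetectable f h N) ∧
    (∀ N : ℕ, OutputInputStable f h N →
      (∀ x : EuclideanSpace ℝ (Fin n), AnalyticOnNhd ℝ (fun u : ℝ => f x u) univ) →
      f 0 0 = 0 → h 0 = 0 →
      ∃ r : ℕ, r ≤ N ∧ HasRelativeDegree f h r) :=
  ⟨fun _ _ hr hk => hr.outputInputStable hf hh hk,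
    fun _ hN => hN.weaklyUniformlyZeroDetectable hf hh,
    fun _ hN han hf0 hh0 => hN.exists_hasRelativeDegree hf hh han hf0 hh0⟩
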